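/- Let $p$ be a prime with $p\equiv 1\pmod 3$ and let $\mathcal R=\mathbb F_p[u]/\langle u^4-u\rangle$. Let $\xi=g^{(p-1)/3}$ for a primitive element $g$ of $\mathbb F_p$, and put $$\eta_1=1-u^3,\quad \eta_2=3^{-1}(u+u^2+u^3),\quad \eta_3=3^{-1}(\xi u+\xi^2u^2+u^3),\quad \eta_4=3^{-1}(\xi^2u+\xi u^2+u^3).$$ Let $q$ be a prime with $q\equiv 1\pmod 4$ such that $p$ is a (nonzero) quadratic residue modulo $q$. Let $\chi$ be the Legendre symbol modulo $q$, let $\alpha$ be a primitive $q$-th root of unity in some extension field of $\mathbb F_p$, and let $\theta=\sum_{i=1}^{q-1}\chi(i)\alpha^i$. Then $\theta\in\mathbb F_p$. Put $j_1=\sum_{1\le i<q,\ \chi(i)=1}x^i$, $j_2=\sum_{1\le i<q,\ \chi(i)=-1}x^i$, and $$e_1=\tfrac12\bigl(1+\tfrac1q\bigr)+\tfrac12\bigl(\tfrac1q-\tfrac1\theta\bigr)j_1+\tfrac12\bigl(\tfrac1q+\tfrac1\theta\bigr)j_2,\qquad e_2=\tfrac12\bigl(1+\tfrac1q\bigr)+\tfrac12\bigl(\tfrac1q-\tfrac1\theta\bigr)j_2+\tfrac12\bigl(\tfrac1q+\tfrac1\theta\bigr)j_1,$$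 $$\tilde e_1=\tfrac12\bigl(1-\tfrac1q\bigr)-\tfrac12\bigl(\tfrac1q+\tfrac1\theta\bigr)j_1-\tfrac12\bigl(\tfrac1q-\tfrac1\theta\bigr)j_2,\qquad \tilde e_2=\tfrac12\bigl(1-\tfrac1q\bigr)-\tfrac12\bigl(\tfrac1q+\tfrac1\theta\bigr)j_2-\tfrac12\bigl(\tfrac1q-\tfrac1\theta\bigr)j_1 .$$ In $\mathcal R[x]/\langle x^q-1\rangle$ let, for $i=1,2,3,4$, $$Q_i=\langle(1-\eta_i)e_1+\eta_ie_2\rangle,\quad Q_{i+4}=\langle\eta_ie_1+(1-\eta_i)e_2\rangle,\quad S_i=\langle(1-\eta_i)\tilde e_1+\eta_i\tilde e_2\rangle,\quad S_{i+4}=\langle\eta_i\tilde e_1+(1-\eta_i)\tilde e_2\rangle,$$ and, for $j=9,10,11$ with $(k,l)=(1,2),(1,3),(1,4)$ respectively, $$Q_j=\langle(\eta_k+\eta_l)e_1+(1-\eta_k-\eta_l)e_2\rangle,\quad Q_{j+3}=\langle(\eta_k+\eta_l)e_2+(1-\eta_k-\eta_l)e_1\rangle,$$ $$S_j=\langle(\eta_k+\eta_l)\tilde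 e_1+(1-\eta_k-\eta_l)\tilde e_2\rangle,\quad S_{j+3}=\langle(\eta_k+\eta_l)\tilde e_2+(1-\eta_k-\eta_l)\tilde e_1\rangle.$$ Regard these ideals as codes in $\mathcal R^q$ through $(a_0,\dots,a_{q-1})\mapsto a_0+a_1x+\dots+a_{q-1}x^{q-1}$, and let $C^\perp$ denote the dual of a code $C$ with respect to the Euclidean inner product. Then (i) $Q_i^\perp=S_{i+4}$ and $Q_{i+4}^\perp=S_i$ for $i=1,2,3,4$; (ii) $Q_j^\perp=S_{j+3}$ and $Q_{j+3}^\perp=S_j$ for $j=9,10,11$. -/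

import Mathlib

open Polynomial

noncomputable section

namespace QRCodes

/-- The ring `F_p + u F_p + u² F_p + u³ F_p` with `u⁴ = u`. -/
abbrev R (p : ℕ) : Type := AdjoinRoot (X ^ 4 - X : (ZMod p)[X])

/-- The element `u` of `R p`. -/
def u (p : ℕ) : R p := AdjoinRoot.root (X ^ 4 - X : (ZMod p)[X])

/-- The ring `R_q = R[x] / ⟨x ^ q - 1⟩`. -/
abbrev Rq (p q : ℕ) : Type := AdjoinRoot (X ^ q - 1 : (R p)[X])

section Codes

variable (p n : ℕ)

/-- The identification `(a_0, …, a_{n-1}) ↦ a_0 + a_1 x + ⋯ + a_{n-1} x ^ (n-1)` of `R ^ n`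
with `R[x] / ⟨x ^ n - 1⟩`. -/
def toPoly : (Fin n → R p) →ₗ[R p] Rq p n :=
  ∑ i : Fin n, (LinearMap.proj i : (Fin n → R p) →ₗ[R p] R p).smulRight
    ((AdjoinRoot.root (X ^ n - 1 : (R p)[X])) ^ (i : ℕ))

/-- The cyclic code in `R ^ n` that corresponds to the ideal `⟨E⟩` of `R[x] / ⟨x ^ n - 1⟩`. -/
def cyclicCode (E : Rq p n) : Submodule (R p) (Fin n → R p) :=
  ((Ideal.span {E} : Ideal (Rq p n)).restrictScalars (R p)).comap (toPoly p n)

variable {p n}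

/-- The dual code with respect to the Euclidean inner product `x · y = ∑ i, x i * y i`. -/
def dual (C : Submodule (R p) (Fin n → R p)) : Submodule (R p) (Fin n → R p) where
  carrier := {x | ∀ y ∈ C, x ⬝ᵥ y = 0}
  add_mem' := by
    intro a b ha hb y hy
    rw [add_dotProduct, ha y hy, hb y hy, add_zero]
  zero_mem' := by
    intro y _
    exact zero_dotProduct y
  smul_mem' := by
    intro c a ha y hy
    rw [smul_dotProduct, ha y hy, smul_zero]

end Codes

section Eta

variable {p : ℕ} [Fact p.Prime] (ξ : ZMod p)

/-- The four elements `η_1, η_2, η_3, η_4` of `R`, where `ξ` is a cube root of unity. -/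
def eta1 (p : ℕ) : R p := 1 - u p ^ 3

def eta2 (p : ℕ) [Fact p.Prime] : R p := (3 : ZMod p)⁻¹ • (u p + u p ^ 2 + u p ^ 3)

def eta3 : R p := (3 : ZMod p)⁻¹ • (ξ • u p + ξ ^ 2 • u p ^ 2 + u p ^ 3)

def eta4 : R p := (3 : ZMod p)⁻¹ • (ξ ^ 2 • u p + ξ • u p ^ 2 + u p ^ 3)

end Eta

section Idempotents

variable (p q : ℕ) [Fact p.Prime] [Fact q.Prime]

/-- `j_1(x) = ∑ x ^ i` over the quadratic residues `i` modulo `q`. -/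
def j1 : (ZMod p)[X] := ∑ i ∈ (Finset.Ico 1 q).filter (fun i : ℕ => legendreSym q (i : ℤ) = 1), X ^ i

/-- `j_2(x) = ∑ x ^ i` over the quadratic non-residues `i` modulo `q`. -/
def j2 : (ZMod p)[X] := ∑ i ∈ (Finset.Ico 1 q).filter (fun i : ℕ => legendreSym q (i : ℤ) = -1), X ^ i

/-- The Gaussian sum `∑ χ(i) α ^ i`, `1 ≤ i ≤ q - 1`, `χ` the Legendre symbol modulo `q`. -/
def gaussianSum {K : Type*} [Field K] (α : K) : K :=
  ∑ i ∈ Finset.Ico (1 : ℕ) q, ((legendreSym q (i : ℤ) : ℤ) : K) * α ^ i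

variable (θ : ZMod p)

/-- `e_1 = E_q(x)`, for the value `θ` of the Gaussian sum. -/
def e1 : (ZMod p)[X] :=
  C (1 / 2 * (1 + 1 / (q : ZMod p))) + C (1 / 2 * (1 / (q : ZMod p) - 1 / θ)) * j1 p q
    + C (1 / 2 * (1 / (q : ZMod p) + 1 / θ)) * j2 p q

/-- `e_2 = E_n(x)`. -/
def e2 : (ZMod p)[X] :=
  C (1 / 2 * (1 + 1 / (q : ZMod p))) + C (1 / 2 * (1 / (q : ZMod p) - 1 / θ)) * j2 p q
    + C (1 / 2 * (1 / (q : ZMod p) + 1 / θ)) * j1 p q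

/-- `ẽ_1 = F_q(x)`. -/
def f1 : (ZMod p)[X] :=
  C (1 / 2 * (1 - 1 / (q : ZMod p))) - C (1 / 2 * (1 / (q : ZMod p) + 1 / θ)) * j1 p q
    - C (1 / 2 * (1 / (q : ZMod p) - 1 / θ)) * j2 p q

/-- `ẽ_2 = F_n(x)`. -/
def f2 : (ZMod p)[X] :=
  C (1 / 2 * (1 - 1 / (q : ZMod p))) - C (1 / 2 * (1 / (q : ZMod p) + 1 / θ)) * j2 p q
    - C (1 / 2 * (1 / (q : ZMod p) - 1 / θ)) * j1 p q

end Idempotents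

section QR

variable (p q : ℕ) [Fact p.Prime] [Fact q.Prime]

/-- The class in `R_q` of `η_1 a + η_2 b + η_3 c + η_4 d`, for polynomials over `F_p`. -/
def mix (ξ : ZMod p) (a b c d : (ZMod p)[X]) : Rq p q :=
  AdjoinRoot.mk (X ^ q - 1 : (R p)[X])
    (C (eta1 p) * a.map (algebraMap (ZMod p) (R p))
      + C (eta2 p) * b.map (algebraMap (ZMod p) (R p))
      + C (eta3 ξ) * c.map (algebraMap (ZMod p) (R p))
      + C (eta4 ξ) * d.map (algebraMap (ZMod p) (R p)))

/-- The fourteen generators that are formed from a pair `e, f` of polynomials over `F_p`,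
numbered from `1` to `14` (other indices are not used). -/
def gen (ξ : ZMod p) (e f : (ZMod p)[X]) : ℕ → Rq p q
  | 1 => mix p q ξ f e e e
  | 2 => mix p q ξ e f e e
  | 3 => mix p q ξ e e f e
  | 4 => mix p q ξ e e e f
  | 5 => mix p q ξ e f f f
  | 6 => mix p q ξ f e f f
  | 7 => mix p q ξ f f e f
  | 8 => mix p q ξ f f f e
  | 9 => mix p q ξ e e f f
  | 10 => mix p q ξ e f e f
  | 11 => mix p q ξ e f f e
  | 12 => mix p q ξ f f e e
  | 13 => mix p q ξ f e f e
  | 14 => mix p q ξ f e e f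
  | _ => 0

/-- The quadratic residue codes `Q_1, …, Q_14` of length `q` over `R`. -/
def Q (ξ θ : ZMod p) (i : ℕ) : Submodule (R p) (Fin q → R p) :=
  cyclicCode p q (gen p q ξ (e1 p q θ) (e2 p q θ) i)

/-- The quadratic residue codes `S_1, …, S_14` of length `q` over `R`. -/
def S (ξ θ : ZMod p) (i : ℕ) : Submodule (R p) (Fin q → R p) :=
  cyclicCode p q (gen p q ξ (f1 p q θ) (f2 p q θ) i)

end QR

end QRCodes

end

/-! The Euclidean product of two words is the constant coefficient of `a(x) b(x⁻¹)`, so if `E` is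
fixed by `x ↦ x⁻¹`, the dual of `⟨E⟩` is the annihilator of `E`; this is `⟨E'⟩` as soon as `E + E' =
1` and `E E' = 0` (`dual_cyclicCode_of_isIdempotent`).

Such pairs come from Gauss sums. In `R[x]/⟨x^q - 1⟩` let `s` be the sum of all powers of `x` and `t
= j₁ - j₂`, the Gauss sum of the character `a ↦ x^a`. Then `s² = q s`, `s t = 0` and, as `χ(-1) =
1`, `t² = q - s`. Hence `(s/q ± t/θ)² = 1` when `θ² = q`, and the halves `(1 ± (s/q + d t))/2` with
`d = ±1/θ` are complementary (`isComplementary_of_eq`): `e₁` pairs with `ẽ₂`, `e₂` with `ẽ₁`. The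
orthogonal decomposition `η₁ + η₂ + η₃ + η₄ = 1` carries this over to the mixed generators
(`dual_cyclicCode_mix`). Quadratic reciprocity puts `θ` in `F_p`. -/

noncomputable section

/-! ### Quadratic Gauss sums over a commutative ring -/

section GaussSums

open Finset

variable {F : Type*} [Field F] [Fintype F] {B : Type*} [CommRing B]

/-- The factor `ψ a` only translates the summation variable. This absorption rule takes the place of
the vanishing of `∑ ψ`, which is not available here. -/
theorem sum_addChar_mul_apply (ψ : AddChar F B) (a : F) : (∑ x, ψ x) * ψ a = ∑ x, ψ x := by
  simp_rw [sum_mul, ← AddChar.map_add_eq_mul]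
  exact Equiv.sum_comp (Equiv.addRight a) ψ

theorem sum_addChar_sq (ψ : AddChar F B) : (∑ x, ψ x) ^ 2 = Fintype.card F * ∑ x, ψ x := by
  rw [sq, mul_sum, sum_congr rfl fun a _ => sum_addChar_mul_apply ψ a]
  simp

theorem sum_addChar_inv (ψ : AddChar F B) : ∑ x, ψ⁻¹ x = ∑ x, ψ x :=
  Equiv.sum_comp (Equiv.neg F) ψ

variable [DecidableEq F]

/-- The additive convolution of the quadratic character with itself. -/
theorem sum_quadraticChar_mul_sub (hF : ringChar F ≠ 2) (t : F) :
    ∑ x : F, quadraticChar F x * quadraticChar F (t - x) =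
      quadraticChar F (-1) * ((if t = 0 then (Fintype.card F : ℤ) else 0) - 1) := by
  split_ifs with ht
  · subst ht
    have h : ∀ x : F, quadraticChar F x * quadraticChar F (0 - x) =
        quadraticChar F (-1) * (1 - if x = 0 then 1 else 0) := by
      intro x
      rw [zero_sub, neg_eq_neg_one_mul, map_mul]
      split_ifs with hx
      · simp [hx]
      · linear_combination quadraticChar F (-1) * quadraticChar_sq_one hx
    rw [sum_congr rfl fun x _ => h x, ← mul_sum, sum_sub_distrib]
    simp
  · have hJ := jacobiSum_nontrivial_inv (quadraticChar_ne_one hF)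
    rw [(quadraticChar_isQuadratic F).inv, jacobiSum] at hJ
    -- Scaling `x` to `t x` produces a factor `χ(t)² = 1` and leaves the Jacobi sum `J(χ, χ) = J(χ,
    -- χ⁻¹) = -χ(-1)`.
    rw [← Equiv.sum_comp (Equiv.mulLeft₀ t ht)]
    have h : ∀ x : F, quadraticChar F (t * x) * quadraticChar F (t - t * x) =
        quadraticChar F x * quadraticChar F (1 - x) := by
      intro x
      rw [← mul_one_sub, map_mul, map_mul]
      linear_combination quadraticChar F x * quadraticChar F (1 - x) * quadraticChar_sq_one ht
    simp only [Equiv.mulLeft₀_apply, h, hJ]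
    ring

/-- The quadratic Gauss sum of an additive character that need not be primitive, with values in a
ring that need not be a domain. -/
theorem gaussSum_quadraticChar_sq (hF : ringChar F ≠ 2) (ψ : AddChar F B) :
    gaussSum ((quadraticChar F).ringHomComp (Int.castRingHom B)) ψ ^ 2 =
      (quadraticChar F (-1) : B) * (Fintype.card F - ∑ a, ψ a) := by
  rw [sq, gaussSum_mul]
  have h : ∀ t : F, ∑ x : F, (quadraticChar F).ringHomComp (Int.castRingHom B) x *
      (quadraticChar F).ringHomComp (Int.castRingHom B) (t - x) * ψ t =
      (quadraticChar F (-1) : B) * ((if t = 0 then (Fintype.card F : B) else 0) - ψ t) := by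
    intro t
    have := congrArg (Int.cast : ℤ → B) (sum_quadraticChar_mul_sub hF t)
    push_cast at this
    simp only [MulChar.ringHomComp_apply, eq_intCast]
    rw [← sum_mul, this]
    split_ifs with ht
    · simp [ht]
    · ring
  rw [sum_congr rfl fun t _ => h t, ← mul_sum, sum_sub_distrib]
  simp

/-- The sum absorbs every `ψ a`, and what remains is `∑ χ(a) = 0`. -/
theorem gaussSum_quadraticChar_mul_sum (hF : ringChar F ≠ 2) (ψ : AddChar F B) :
    gaussSum ((quadraticChar F).ringHomComp (Int.castRingHom B)) ψ * ∑ x, ψ x = 0 := by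
  have h : ∀ a : F, (quadraticChar F).ringHomComp (Int.castRingHom B) a * ψ a * ∑ x, ψ x =
      (quadraticChar F a : B) * ∑ x, ψ x := by
    intro a
    rw [mul_assoc, mul_comm (ψ a), sum_addChar_mul_apply]
    simp
  rw [gaussSum, sum_mul, sum_congr rfl fun a _ => h a, ← sum_mul, ← Int.cast_sum,
    quadraticChar_sum_zero hF, Int.cast_zero, zero_mul]

theorem gaussSum_quadraticChar_inv (ψ : AddChar F B) :
    gaussSum ((quadraticChar F).ringHomComp (Int.castRingHom B)) ψ⁻¹ =
      (quadraticChar F (-1) : B) *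
        gaussSum ((quadraticChar F).ringHomComp (Int.castRingHom B)) ψ := by
  rw [gaussSum, gaussSum, mul_sum, ← Equiv.sum_comp (Equiv.neg F)]
  refine sum_congr rfl fun a _ => ?_
  rw [Equiv.neg_apply, AddChar.inv_apply, neg_neg, MulChar.ringHomComp_apply,
    MulChar.ringHomComp_apply, neg_eq_neg_one_mul a, map_mul]
  push_cast [eq_intCast]
  ring

theorem sum_range_eq_sum_zmod {M : Type*} [AddCommMonoid M] (n : ℕ) [NeZero n] (f : ℕ → M) :
    ∑ i ∈ range n, f i = ∑ a : ZMod n, f a.val :=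
  sum_bij' (fun i _ => (i : ZMod n)) (fun a _ => a.val) (fun _ _ => mem_univ _)
    (fun a _ => mem_range.2 a.val_lt) (fun _ hi => ZMod.val_cast_of_lt (mem_range.1 hi))
    (fun a _ => ZMod.natCast_zmod_val a)
    (fun _ hi => by rw [ZMod.val_cast_of_lt (mem_range.1 hi)])

theorem sum_Ico_legendreSym_mul_pow (q : ℕ) [Fact q.Prime] {x : B} (hx : x ^ q = 1) :
    ∑ i ∈ Ico 1 q, ((legendreSym q (i : ℤ) : ℤ) : B) * x ^ i =
      gaussSum ((quadraticChar (ZMod q)).ringHomComp (Int.castRingHom B))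
        (AddChar.zmodChar q hx) := by
  have h := sum_range_eq_sum_zmod q fun i => ((legendreSym q (i : ℤ) : ℤ) : B) * x ^ i
  rw [range_eq_Ico, sum_eq_sum_Ico_succ_bot (Fact.out : q.Prime).pos] at h
  simpa [legendreSym, gaussSum, AddChar.zmodChar_apply] using h

end GaussSums

/-! ### Duals of cyclic codes as annihilators -/

section Duality

namespace QRCodes

instance nontrivial_R (p : ℕ) [Fact p.Prime] : Nontrivial (R p) :=
  AdjoinRoot.nontrivial _ (by
    rw [degree_sub_eq_left_of_degree_lt] <;> simp)

theorem root_pow_eq_one (p n : ℕ) : AdjoinRoot.root (X ^ n - 1 : (R p)[X]) ^ n = 1 := by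
  have h := AdjoinRoot.eval₂_root (X ^ n - 1 : (R p)[X])
  simpa [sub_eq_zero] using h

variable (p n : ℕ)

/-- The involution of `R[x] / ⟨x ^ n - 1⟩` that sends `x` to `x⁻¹ = x ^ (n - 1)`. -/
def inversion : Rq p n →ₐ[R p] Rq p n :=
  AdjoinRoot.liftAlgHom _ (Algebra.ofId _ _) (AdjoinRoot.root _ ^ (n - 1)) (by
    rw [eval₂_sub, eval₂_X_pow, eval₂_one, ← pow_mul, mul_comm, pow_mul, root_pow_eq_one, one_pow,
      sub_self])

theorem inversion_root : inversion p n (AdjoinRoot.root _) = AdjoinRoot.root _ ^ (n - 1) :=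
  AdjoinRoot.liftAlgHom_root _ _ _ _

theorem monic_X_pow_sub_one [NeZero n] : (X ^ n - 1 : (R p)[X]).Monic := by
  simpa using monic_X_pow_sub_C (1 : R p) (NeZero.ne n)

/-- The constant coefficient of the reduced representative. -/
def constCoeff [NeZero n] : Rq p n →ₗ[R p] R p :=
  (lcoeff (R p) 0).comp (AdjoinRoot.modByMonicHom (monic_X_pow_sub_one p n))

theorem toPoly_apply (a : Fin n → R p) :
    toPoly p n a = ∑ i, a i • AdjoinRoot.root (X ^ n - 1 : (R p)[X]) ^ (i : ℕ) := by
  simp [toPoly]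

variable [Fact p.Prime] [NeZero n]

theorem constCoeff_root_pow {i : ℕ} (hi : i < n) :
    constCoeff p n (AdjoinRoot.root _ ^ i) = if i = 0 then 1 else 0 := by
  have hd : (X ^ n - 1 : (R p)[X]).degree = n := by
    simpa using degree_X_pow_sub_C (NeZero.pos n) (1 : R p)
  rw [← AdjoinRoot.mk_X, ← map_pow, constCoeff, LinearMap.comp_apply,
    AdjoinRoot.modByMonicHom_mk, (modByMonic_eq_self_iff (monic_X_pow_sub_one p n)).2]
  · simp [coeff_X_pow, eq_comm]
  · rw [hd, degree_X_pow]
    exact_mod_cast hi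

theorem constCoeff_root_pow_mul (i j : Fin n) :
    constCoeff p n (AdjoinRoot.root _ ^ (i : ℕ) * inversion p n (AdjoinRoot.root _ ^ (j : ℕ))) =
      if i = j then 1 else 0 := by
  have hi := i.2
  have hj := j.2
  rw [map_pow, inversion_root, ← pow_mul]
  have hinv : AdjoinRoot.root (X ^ n - 1 : (R p)[X]) ^ ((n - 1) * (j : ℕ)) =
      AdjoinRoot.root (X ^ n - 1 : (R p)[X]) ^ (n - j) := by
    have h1 : (n - 1) * (j : ℕ) + j = n * j := by
      rw [← Nat.succ_mul, Nat.succ_eq_add_one, Nat.sub_add_cancel NeZero.one_le]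
    have hu : IsUnit (AdjoinRoot.root (X ^ n - 1 : (R p)[X]) ^ (j : ℕ)) :=
      (IsUnit.of_pow_eq_one (root_pow_eq_one p n) (NeZero.ne n)).pow _
    refine hu.mul_right_cancel ?_
    rw [← pow_add, ← pow_add, h1, pow_mul, root_pow_eq_one, one_pow, Nat.sub_add_cancel hj.le,
      root_pow_eq_one]
  rw [hinv, ← pow_add]
  -- The exponent `i + (n - j)` lies strictly between `0` and `n` if `i < j`; otherwise it reduces
  -- to `i - j`, which is `0` only for `i = j`. The case `j = 0` falls under the second.
  rcases lt_or_ge (i : ℕ) j with h | h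
  · rw [constCoeff_root_pow p n (by omega), if_neg (by omega), if_neg (by omega)]
  · rw [show (i : ℕ) + (n - j) = (i - j) + n by omega, pow_add, root_pow_eq_one, mul_one,
      constCoeff_root_pow p n (by omega)]
    exact if_congr (by omega) rfl rfl

theorem dotProduct_eq_constCoeff (a b : Fin n → R p) :
    a ⬝ᵥ b = constCoeff p n (toPoly p n a * inversion p n (toPoly p n b)) := by
  simp only [toPoly_apply, map_sum, map_smul, Finset.sum_mul_sum, smul_mul_smul_comm,
    constCoeff_root_pow_mul]
  simp [dotProduct]

theorem toPoly_surjective : Function.Surjective (toPoly p n) := by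
  intro a
  obtain ⟨f, rfl⟩ := AdjoinRoot.mk_surjective a
  have hm := monic_X_pow_sub_one p n
  have hd : (X ^ n - 1 : (R p)[X]).natDegree = n := by
    simpa using natDegree_X_pow_sub_C (n := n) (r := (1 : R p))
  refine ⟨fun i => (f %ₘ (X ^ n - 1)).coeff i, ?_⟩
  have hlt : (f %ₘ (X ^ n - 1)).natDegree < n := by
    conv_rhs => rw [← hd]
    refine natDegree_modByMonic_lt f hm fun h => NeZero.ne n ?_
    rw [← hd, h, natDegree_one]
  have hf : AdjoinRoot.mk (X ^ n - 1 : (R p)[X]) f = AdjoinRoot.mk _ (f %ₘ (X ^ n - 1)) := by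
    rw [← AdjoinRoot.modByMonicHom_mk hm]
    exact (AdjoinRoot.mk_leftInverse hm _).symm
  rw [hf]
  generalize f %ₘ (X ^ n - 1) = r at hlt
  conv_rhs => rw [r.as_sum_range' n hlt, map_sum, Finset.sum_range]
  rw [toPoly_apply]
  refine Finset.sum_congr rfl fun i _ => ?_
  rw [← C_mul_X_pow_eq_monomial, map_mul, map_pow, AdjoinRoot.mk_X, Algebra.smul_def,
    AdjoinRoot.mk_C, AdjoinRoot.algebraMap_eq]

/-- Since `E` is fixed by the inversion, pairing `a` with `E w` is the same as pairing `a E` with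
`w`; nondegeneracy of the dot product gives the annihilator. -/
theorem mem_dual_cyclicCode_iff {E : Rq p n} (hE : inversion p n E = E) (a : Fin n → R p) :
    a ∈ dual (cyclicCode p n E) ↔ toPoly p n a * E = 0 := by
  constructor
  · intro ha
    obtain ⟨z, hz⟩ := toPoly_surjective p n (toPoly p n a * E)
    have h0 : z = 0 := by
      refine dotProduct_eq_zero z fun w => ?_
      obtain ⟨y, hy⟩ := toPoly_surjective p n (E * toPoly p n w)
      have h := ha y (Ideal.mem_span_singleton'.2 ⟨toPoly p n w, by rw [hy, mul_comm]⟩)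
      rwa [dotProduct_eq_constCoeff, hy, map_mul (inversion p n), hE, ← mul_assoc, ← hz,
        ← dotProduct_eq_constCoeff] at h
    rw [← hz, h0, map_zero]
  · intro ha y hy
    obtain ⟨c, hc⟩ := Ideal.mem_span_singleton'.1 (show toPoly p n y ∈ Ideal.span {E} from hy)
    rw [dotProduct_eq_constCoeff, ← hc, map_mul (inversion p n), hE, mul_left_comm, ha, mul_zero, map_zero]

/-- The dual of the cyclic code generated by an idempotent `E` that is fixed by `x ↦ x⁻¹` is
generated by the complementary idempotent. -/
theorem dual_cyclicCode_of_isIdempotent {E E' : Rq p n} (hE : inversion p n E = E)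
    (hadd : E + E' = 1) (hmul : E * E' = 0) :
    dual (cyclicCode p n E) = cyclicCode p n E' := by
  ext a
  rw [mem_dual_cyclicCode_iff p n hE]
  change _ ↔ toPoly p n a ∈ Ideal.span {E'}
  rw [Ideal.mem_span_singleton']
  constructor
  · intro h
    exact ⟨toPoly p n a, by linear_combination toPoly p n a * hadd - h⟩
  · rintro ⟨c, hc⟩
    linear_combination (-E) * hc + c * hmul

end QRCodes

end Duality

/-! ### The decomposition of `R` and the generating idempotents -/

section Generators

namespace QRCodes

theorem u_pow_four (p : ℕ) : u p ^ 4 = u p := by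
  have h := AdjoinRoot.eval₂_root (X ^ 4 - X : (ZMod p)[X])
  simpa [u, sub_eq_zero] using h

/-- The additive character `a ↦ x ^ a` of `ZMod q` with values in `R[x] / ⟨x ^ q - 1⟩`. -/
def rootChar (p q : ℕ) [Fact q.Prime] : AddChar (ZMod q) (Rq p q) := AddChar.zmodChar q (root_pow_eq_one p q)

theorem inversion_rootChar (p q : ℕ) [Fact q.Prime] (a : ZMod q) :
    inversion p q (rootChar p q a) = (rootChar p q)⁻¹ a := by
  have h : -a = (((q - 1) * a.val : ℕ) : ZMod q) := by
    rw [Nat.cast_mul, Nat.cast_pred (Fact.out : q.Prime).pos]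
    simp
  rw [AddChar.inv_apply, h, rootChar, AddChar.zmodChar_apply', AddChar.zmodChar_apply, map_pow,
    inversion_root, pow_mul]

variable {p q : ℕ} [Fact p.Prime]

section Eta

variable {ξ : ZMod p} (h3 : (3 : ZMod p) ≠ 0) (hξ : ξ ^ 2 + ξ + 1 = 0)

/-- The powers `u, u², u³` form a cyclic group of order 3 with identity `u³`, killed by `1 - u³`;
`η₂, η₃, η₄` are its character idempotents. Only their orthogonality and their sum are needed below.
-/
theorem eta1_mul_eta2 : eta1 p * eta2 p = 0 := by
  rw [eta1, eta2, Algebra.smul_def]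
  linear_combination -algebraMap (ZMod p) (R p) 3⁻¹ * (1 + u p + u p ^ 2) * u_pow_four p

theorem eta1_mul_eta3 : eta1 p * eta3 ξ = 0 := by
  simp only [eta1, eta3, Algebra.smul_def, map_pow]
  linear_combination -algebraMap (ZMod p) (R p) 3⁻¹ *
    (algebraMap (ZMod p) (R p) ξ + algebraMap (ZMod p) (R p) ξ ^ 2 * u p + u p ^ 2) * u_pow_four p

theorem eta1_mul_eta4 : eta1 p * eta4 ξ = 0 := by
  simp only [eta1, eta4, Algebra.smul_def, map_pow]
  linear_combination -algebraMap (ZMod p) (R p) 3⁻¹ *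
    (algebraMap (ZMod p) (R p) ξ ^ 2 + algebraMap (ZMod p) (R p) ξ * u p + u p ^ 2) * u_pow_four p

include hξ

theorem algebraMap_cube_root :
    algebraMap (ZMod p) (R p) ξ ^ 2 + algebraMap (ZMod p) (R p) ξ + 1 = 0 := by
  rw [← map_pow, ← map_add, ← map_one (algebraMap (ZMod p) (R p)), ← map_add, hξ, map_zero]

theorem eta2_mul_eta3 : eta2 p * eta3 ξ = 0 := by
  have h := algebraMap_cube_root hξ
  simp only [eta2, eta3, Algebra.smul_def, map_pow]
  generalize algebraMap (ZMod p) (R p) ξ = x at h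
  linear_combination algebraMap (ZMod p) (R p) 3⁻¹ ^ 2 * ((u p + u p ^ 2 + u p ^ 3) * h +
    (1 + x + x ^ 2 + (1 + x ^ 2) * u p + u p ^ 2) * u_pow_four p)

theorem eta2_mul_eta4 : eta2 p * eta4 ξ = 0 := by
  have h := algebraMap_cube_root hξ
  simp only [eta2, eta4, Algebra.smul_def, map_pow]
  generalize algebraMap (ZMod p) (R p) ξ = x at h
  linear_combination algebraMap (ZMod p) (R p) 3⁻¹ ^ 2 * ((u p + u p ^ 2 + u p ^ 3) * h +
    (1 + x + x ^ 2 + (1 + x) * u p + u p ^ 2) * u_pow_four p)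

theorem eta3_mul_eta4 : eta3 ξ * eta4 ξ = 0 := by
  have h := algebraMap_cube_root hξ
  simp only [eta3, eta4, Algebra.smul_def, map_pow]
  generalize algebraMap (ZMod p) (R p) ξ = x at h
  -- After reduction by `u⁴ = u`, the coefficient of `u³` is `x⁴ + x² + 1 = (x² + x + 1)(x² - x +
  -- 1)`; those of `u` and `u²` are `x (x² + x + 1)`.
  linear_combination algebraMap (ZMod p) (R p) 3⁻¹ ^ 2 *
    ((x * u p + x * u p ^ 2 + (x ^ 2 - x + 1) * u p ^ 3) * h +
    (x + x ^ 2 + x ^ 3 + (x + x ^ 2) * u p + u p ^ 2) * u_pow_four p)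

include h3

theorem sum_eta : eta1 p + eta2 p + eta3 ξ + eta4 ξ = 1 := by
  have h := algebraMap_cube_root hξ
  have h3' : algebraMap (ZMod p) (R p) 3⁻¹ * 3 = 1 := by
    rw [← map_ofNat (algebraMap (ZMod p) (R p)) 3, ← map_mul, inv_mul_cancel₀ h3, map_one]
  simp only [eta1, eta2, eta3, eta4, Algebra.smul_def, map_pow]
  generalize algebraMap (ZMod p) (R p) ξ = x at h
  linear_combination algebraMap (ZMod p) (R p) 3⁻¹ * (u p + u p ^ 2) * h + u p ^ 3 * h3'

end Eta

variable (p q) in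
/-- The canonical map from `F_p[x]` to `R[x] / ⟨x ^ q - 1⟩`. -/
def residue : (ZMod p)[X] →+* Rq p q :=
  (AdjoinRoot.mk _).comp (mapRingHom (algebraMap (ZMod p) (R p)))

theorem residue_X : residue p q X = AdjoinRoot.root _ := by
  simp [residue]

theorem residue_C (c : ZMod p) : residue p q (C c) = algebraMap (R p) _ (algebraMap _ _ c) := by
  simp [residue, AdjoinRoot.algebraMap_eq]

theorem mix_eq (ξ : ZMod p) (a b c d : (ZMod p)[X]) :
    mix p q ξ a b c d = algebraMap (R p) _ (eta1 p) * residue p q a +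
      algebraMap (R p) _ (eta2 p) * residue p q b + algebraMap (R p) _ (eta3 ξ) * residue p q c +
      algebraMap (R p) _ (eta4 ξ) * residue p q d := by
  simp [mix, residue, AdjoinRoot.algebraMap_eq]

/-- `a` and `b` become complementary idempotents modulo `x ^ q - 1`, and `a` is invariant
under `x ↦ x⁻¹`. -/
structure IsComplementary (q : ℕ) (a b : (ZMod p)[X]) : Prop where
  inversion_eq : inversion p q (residue p q a) = residue p q a
  add_eq_one : residue p q a + residue p q b = 1
  mul_eq_zero : residue p q a * residue p q b = 0

variable [Fact q.Prime]

theorem dual_cyclicCode_mix {ξ : ZMod p} (h3 : (3 : ZMod p) ≠ 0) (hξ : ξ ^ 2 + ξ + 1 = 0)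
    {a b c d a' b' c' d' : (ZMod p)[X]} (ha : IsComplementary q a a')
    (hb : IsComplementary q b b') (hc : IsComplementary q c c') (hd : IsComplementary q d d') :
    dual (cyclicCode p q (mix p q ξ a b c d)) = cyclicCode p q (mix p q ξ a' b' c' d') := by
  set φ := algebraMap (R p) (Rq p q) with hφ
  have horth : ∀ {x y : R p}, x * y = 0 → φ x * φ y = 0 := fun h => by
    rw [← map_mul, h, map_zero]
  have h12 := horth (eta1_mul_eta2 (p := p))
  have h13 := horth (eta1_mul_eta3 (ξ := ξ))
  have h14 := horth (eta1_mul_eta4 (ξ := ξ))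
  have h23 := horth (eta2_mul_eta3 hξ)
  have h24 := horth (eta2_mul_eta4 hξ)
  have h34 := horth (eta3_mul_eta4 hξ)
  have hsum : φ (eta1 p) + φ (eta2 p) + φ (eta3 ξ) + φ (eta4 ξ) = 1 := by
    rw [← map_add, ← map_add, ← map_add, sum_eta h3 hξ, map_one]
  apply dual_cyclicCode_of_isIdempotent
  · simp only [mix_eq, map_add, map_mul, AlgHom.commutes, ha.inversion_eq, hb.inversion_eq,
      hc.inversion_eq, hd.inversion_eq]
  · rw [mix_eq, mix_eq, ← hφ]
    linear_combination φ (eta1 p) * ha.add_eq_one + φ (eta2 p) * hb.add_eq_one +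
      φ (eta3 ξ) * hc.add_eq_one + φ (eta4 ξ) * hd.add_eq_one + hsum
  · rw [mix_eq, mix_eq, ← hφ]
    have ha := ha.mul_eq_zero
    have hb := hb.mul_eq_zero
    have hc := hc.mul_eq_zero
    have hd := hd.mul_eq_zero
    generalize residue p q a = a, residue p q a' = a', residue p q b = b, residue p q b' = b',
      residue p q c = c, residue p q c' = c', residue p q d = d, residue p q d' = d' at *
    linear_combination φ (eta1 p) ^ 2 * ha + φ (eta2 p) ^ 2 * hb + φ (eta3 ξ) ^ 2 * hc +
      φ (eta4 ξ) ^ 2 * hd + (a * b' + b * a') * h12 + (a * c' + c * a') * h13 +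
      (a * d' + d * a') * h14 + (b * c' + c * b') * h23 + (b * d' + d * b') * h24 +
      (c * d' + d * c') * h34

/-! ### Complementary pairs from the Gauss sum -/

section Idempotents

open Finset

theorem legendreSym_eq_one_or_neg_one_of_mem_Ico {i : ℕ} (hi : i ∈ Ico 1 q) :
    legendreSym q (i : ℤ) = 1 ∨ legendreSym q (i : ℤ) = -1 := by
  rw [mem_Ico] at hi
  refine legendreSym.eq_one_or_neg_one q ?_
  rw [Int.cast_natCast, Ne, ZMod.natCast_eq_zero_iff]
  exact Nat.not_dvd_of_pos_of_lt hi.1 hi.2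

theorem one_add_j1_add_j2 : 1 + (j1 p q + j2 p q) = ∑ i ∈ range q, X ^ i := by
  rw [range_eq_Ico, sum_eq_sum_Ico_succ_bot (Fact.out : q.Prime).pos, pow_zero, j1, j2,
    sum_filter, sum_filter, ← sum_add_distrib]
  refine congrArg _ (sum_congr rfl fun i hi => ?_)
  rcases legendreSym_eq_one_or_neg_one_of_mem_Ico hi with h | h <;> simp [h]

theorem j1_sub_j2 :
    j1 p q - j2 p q = ∑ i ∈ Ico 1 q, ((legendreSym q (i : ℤ) : ℤ) : (ZMod p)[X]) * X ^ i := by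
  rw [j1, j2, sum_filter, sum_filter, ← sum_sub_distrib]
  refine sum_congr rfl fun i hi => ?_
  rcases legendreSym_eq_one_or_neg_one_of_mem_Ico hi with h | h <;> simp [h]

variable (p q) in
theorem residue_sum : residue p q (1 + (j1 p q + j2 p q)) = ∑ a, rootChar p q a := by
  rw [one_add_j1_add_j2, map_sum, sum_range_eq_sum_zmod]
  simp only [map_pow, residue_X]
  rfl

variable (p q) in
theorem residue_diff : residue p q (j1 p q - j2 p q) =
    gaussSum ((quadraticChar (ZMod q)).ringHomComp (Int.castRingHom _)) (rootChar p q) := by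
  rw [j1_sub_j2, map_sum, rootChar, ← sum_Ico_legendreSym_mul_pow]
  simp only [map_mul, map_intCast, map_pow, residue_X]

theorem quadraticChar_neg_one_of_mod_four (hq : q ≡ 1 [MOD 4]) :
    ringChar (ZMod q) ≠ 2 ∧ quadraticChar (ZMod q) (-1) = 1 := by
  have h2 : ringChar (ZMod q) ≠ 2 := by
    rw [ZMod.ringChar_zmod_n]
    rintro rfl
    exact absurd hq (by decide)
  refine ⟨h2, ?_⟩
  rw [quadraticChar_neg_one h2, ZMod.card, ZMod.χ₄_nat_one_mod_four hq]

theorem inversion_residue_sum : inversion p q (residue p q (1 + (j1 p q + j2 p q))) =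
    residue p q (1 + (j1 p q + j2 p q)) := by
  rw [residue_sum, map_sum]
  simp only [inversion_rootChar]
  exact sum_addChar_inv _

theorem inversion_residue_diff (hq : q ≡ 1 [MOD 4]) :
    inversion p q (residue p q (j1 p q - j2 p q)) = residue p q (j1 p q - j2 p q) := by
  have h := gaussSum_quadraticChar_inv (rootChar p q)
  rw [(quadraticChar_neg_one_of_mod_four hq).2, Int.cast_one, one_mul] at h
  rw [residue_diff]
  conv_rhs => rw [← h]
  rw [gaussSum, gaussSum, map_sum]
  refine sum_congr rfl fun a _ => ?_
  rw [map_mul, inversion_rootChar]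
  simp

/-- The four idempotents of quadratic residue codes are, up to the signs of `c` and `d`, of the
form `(1 + c s + d t) / 2` with `s` the sum of all powers of `x` and `t` the Gauss sum. -/
theorem isComplementary_of_eq (hq : q ≡ 1 [MOD 4]) (h2 : (2 : ZMod p) ≠ 0) {c d : ZMod p}
    (hc : c * q = 1) (hd : d ^ 2 = c) {a b : (ZMod p)[X]}
    (ha : a = C (1 / 2) * (1 + C c * (1 + (j1 p q + j2 p q)) + C d * (j1 p q - j2 p q)))
    (hb : b = C (1 / 2) * (1 - C c * (1 + (j1 p q + j2 p q)) - C d * (j1 p q - j2 p q))) :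
    IsComplementary q a b := by
  obtain ⟨hF, hneg⟩ := quadraticChar_neg_one_of_mod_four hq
  have hJ := sum_addChar_sq (rootChar p q)
  have hGJ := gaussSum_quadraticChar_mul_sum hF (rootChar p q)
  have hG := gaussSum_quadraticChar_sq hF (rootChar p q)
  rw [hneg, Int.cast_one, one_mul] at hG
  rw [← residue_sum, ← residue_diff] at hGJ
  rw [← residue_sum, ← residue_diff, ZMod.card] at hG
  rw [← residue_sum, ZMod.card] at hJ
  have hh : residue p q (C (1 / 2)) * 2 = 1 := by
    rw [← map_ofNat (residue p q) 2, ← map_ofNat C 2, ← map_mul, ← C_mul,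
      div_mul_cancel₀ _ h2, C_1, map_one]
  have hc' : residue p q (C c) * q = 1 := by
    rw [← map_natCast (residue p q) q, ← map_natCast C q, ← map_mul, ← C_mul, hc, C_1, map_one]
  have hd' : residue p q (C d) ^ 2 = residue p q (C c) := by
    rw [← map_pow, ← C_pow, hd]
  have ha' := congrArg (residue p q) ha
  have hb' := congrArg (residue p q) hb
  -- The explicit arguments keep the images of `1 + (j₁ + j₂)` and `j₁ - j₂` unexpanded, so that the
  -- relations for `s` and `t` apply.
  rw [map_mul, map_add, map_add _ 1, map_mul _ (C c), map_mul _ (C d), map_one] at ha'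
  rw [map_mul, map_sub, map_sub _ 1, map_mul _ (C c), map_mul _ (C d), map_one] at hb'
  refine ⟨?_, ?_, ?_⟩
  · simp only [ha', map_add (inversion p q), map_mul (inversion p q), map_one (inversion p q),
      inversion_residue_sum, inversion_residue_diff hq]
    simp only [residue_C, AlgHom.commutes]
  · rw [ha', hb']
    linear_combination hh
  · rw [ha', hb']
    generalize residue p q (1 + (j1 p q + j2 p q)) = J at *
    generalize residue p q (j1 p q - j2 p q) = G at *
    generalize residue p q (C c) = c, residue p q (C d) = d at *
    generalize residue p q (C (1 / 2)) = h at *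
    -- The product is `h² (1 - (c J + d G)²)`, and the square is `c² q J + d² (q - J) = c J + 1 - c
    -- J = 1`.
    linear_combination -h ^ 2 * (c ^ 2 * hJ + 2 * c * d * hGJ + d ^ 2 * hG + (q - J) * hd' +
      (c * J + 1) * hc')

theorem isComplementary_e1_f2 (hq : q ≡ 1 [MOD 4]) (h2 : (2 : ZMod p) ≠ 0) {θ : ZMod p}
    (hθ : θ ^ 2 = q) (h0 : (q : ZMod p) ≠ 0) : IsComplementary q (e1 p q θ) (f2 p q θ) := by
  refine isComplementary_of_eq hq h2 (c := 1 / q) (d := -(1 / θ)) (by field_simp)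
    (by rw [← hθ]; simp) ?_ ?_
  · simp only [e1, C_mul, C_add, C_sub, C_neg, C_1]
    ring
  · simp only [f2, C_mul, C_add, C_sub, C_neg, C_1]
    ring

theorem isComplementary_e2_f1 (hq : q ≡ 1 [MOD 4]) (h2 : (2 : ZMod p) ≠ 0) {θ : ZMod p}
    (hθ : θ ^ 2 = q) (h0 : (q : ZMod p) ≠ 0) : IsComplementary q (e2 p q θ) (f1 p q θ) := by
  refine isComplementary_of_eq hq h2 (c := 1 / q) (d := 1 / θ) (by field_simp)
    (by rw [← hθ]; simp) ?_ ?_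
  · simp only [e2, C_mul, C_add, C_sub, C_1]
    ring
  · simp only [f1, C_mul, C_add, C_sub, C_1]
    ring

end Idempotents

theorem gaussianSum_sq {K : Type*} [Field K] (hq : q ≡ 1 [MOD 4]) {α : K}
    (hα : IsPrimitiveRoot α q) : gaussianSum q α ^ 2 = q := by
  obtain ⟨hF, hneg⟩ := quadraticChar_neg_one_of_mod_four hq
  have hα0 := hα.geom_sum_eq_zero (Fact.out : q.Prime).one_lt
  rw [sum_range_eq_sum_zmod] at hα0
  rw [gaussianSum, sum_Ico_legendreSym_mul_pow q hα.pow_eq_one, gaussSum_quadraticChar_sq hF, hneg,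
    ZMod.card]
  simp only [AddChar.zmodChar_apply, hα0]
  simp

/-- By reciprocity with `q ≡ 1 mod 4`, `q = s²` in `F_p`; the Gauss sum also squares to `q`, so it
is `s` or `-s`. -/
theorem exists_algebraMap_eq_gaussianSum {K : Type*} [Field K] [Algebra (ZMod p) K]
    (hp2 : p ≠ 2) (hq : q ≡ 1 [MOD 4]) (hpq : legendreSym q p = 1) {α : K}
    (hα : IsPrimitiveRoot α q) :
    ∃ θ : ZMod p, algebraMap (ZMod p) K θ = gaussianSum q α ∧ θ ^ 2 = q := by
  have hp0 : ((p : ℤ) : ZMod q) ≠ 0 := fun h => by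
    rw [(legendreSym.eq_zero_iff q p).2 h] at hpq
    exact zero_ne_one hpq
  have hsq := (legendreSym.eq_one_iff q hp0).1 hpq
  rw [Int.cast_natCast, ZMod.exists_sq_eq_prime_iff_of_mod_four_eq_one hq hp2] at hsq
  obtain ⟨s, hs⟩ := hsq
  have h : gaussianSum q α ^ 2 = algebraMap (ZMod p) K s ^ 2 := by
    rw [gaussianSum_sq hq hα, ← map_pow, sq, ← hs, map_natCast]
  rcases sq_eq_sq_iff_eq_or_eq_neg.1 h with h | h
  · exact ⟨s, h.symm, by rw [hs, sq]⟩
  · exact ⟨-s, by rw [h, map_neg], by rw [hs, neg_sq, sq]⟩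

end QRCodes

end Generators

end

theorem theorem10 (p q : ℕ) [Fact p.Prime] [Fact q.Prime]
    (hp : p ≡ 1 [MOD 3]) (hq : q ≡ 1 [MOD 4]) (hpq : legendreSym q p = 1)
    -- `g` is a primitive element of `F_p` and `ξ = g ^ ((p - 1) / 3)`
    (g ξ : ZMod p) (hg : IsPrimitiveRoot g (p - 1)) (hξ : ξ = g ^ ((p - 1) / 3))
    -- `α` is a primitive `q`-th root of unity in some extension field of `F_p`
    {K : Type*} [Field K] [Algebra (ZMod p) K] (α : K) (hα : IsPrimitiveRoot α q) :
    -- the Gaussian sum is the image of an element `θ` of `F_p` (unique, as `F_p → K` is injective)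
    ∃ θ : ZMod p, algebraMap (ZMod p) K θ = QRCodes.gaussianSum q α ∧
      (∀ i : ℕ, 1 ≤ i → i ≤ 4 →
        QRCodes.dual (QRCodes.Q p q ξ θ i) = QRCodes.S p q ξ θ (i + 4) ∧
        QRCodes.dual (QRCodes.Q p q ξ θ (i + 4)) = QRCodes.S p q ξ θ i) ∧
      (∀ j : ℕ, 9 ≤ j → j ≤ 11 →
        QRCodes.dual (QRCodes.Q p q ξ θ j) = QRCodes.S p q ξ θ (j + 3) ∧
        QRCodes.dual (QRCodes.Q p q ξ θ (j + 3)) = QRCodes.S p q ξ θ j) := by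
  have hpp : p.Prime := Fact.out
  have hp2 : p ≠ 2 := by rintro rfl; exact absurd hp (by decide)
  have hp3 : p ≠ 3 := by rintro rfl; exact absurd hp (by decide)
  have ne_zero : ∀ n : ℕ, n.Prime → p ≠ n → (n : ZMod p) ≠ 0 := fun n hn h h0 =>
    h ((Nat.prime_dvd_prime_iff_eq hpp hn).1 ((ZMod.natCast_eq_zero_iff n p).1 h0))
  have h2 : (2 : ZMod p) ≠ 0 := ne_zero 2 Nat.prime_two hp2
  have h3 : (3 : ZMod p) ≠ 0 := ne_zero 3 Nat.prime_three hp3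
  -- If `p = q`, the Legendre symbol would be `0` instead of `1`.
  have hq0 : (q : ZMod p) ≠ 0 := ne_zero q Fact.out (by
    rintro rfl
    have h := (legendreSym.eq_zero_iff p p).2 (by simp)
    rw [hpq] at h
    exact one_ne_zero h)
  have hξ3 : IsPrimitiveRoot ξ 3 := by
    rw [hξ]
    refine hg.pow (Nat.sub_pos_of_lt hpp.one_lt) ?_
    exact (Nat.div_mul_cancel ((Nat.modEq_iff_dvd' hpp.one_le).1 hp.symm)).symm
  have hξ0 : ξ ^ 2 + ξ + 1 = 0 := by
    have h := hξ3.geom_sum_eq_zero (by norm_num)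
    simp only [Finset.sum_range_succ, Finset.sum_range_zero] at h
    linear_combination h
  obtain ⟨θ, hθK, hθ⟩ := QRCodes.exists_algebraMap_eq_gaussianSum hp2 hq hpq hα
  have h12 := QRCodes.isComplementary_e1_f2 hq h2 hθ hq0
  have h21 := QRCodes.isComplementary_e2_f1 hq h2 hθ hq0
  refine ⟨θ, hθK, ?_⟩
  simp only [QRCodes.Q, QRCodes.S]
  generalize QRCodes.e1 p q θ = a, QRCodes.e2 p q θ = b, QRCodes.f1 p q θ = c,
    QRCodes.f2 p q θ = d at *
  -- Passing from `i` to `i + 4`, or from `j` to `j + 3`, interchanges the two polynomials in `gen`;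
  -- this matches the crossed pairing of `e₁` with `ẽ₂` and `e₂` with `ẽ₁`.
  constructor <;> intro i hi hi' <;> interval_cases i <;> simp only [QRCodes.gen] <;>
    constructor <;> apply QRCodes.dual_cyclicCode_mix h3 hξ0 <;> assumption
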